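/- Let $M$ be a smooth manifold, and let $\mathbb{T}M = TM\oplus T^*M$ carry the pairing $\langle (X,\alpha),(Y,\beta)\rangle=\alpha(Y)+\beta(X)$ and the Dorfman bracket $[\![(X,\alpha),(Y,\beta)]\!]=([X,Y],\mathcal{L}_X\beta-\iota_Y d\alpha)$. An almost Dirac structure is a Lagrangian subbundle of $\mathbb{T}M$; it is a Dirac structure if its space of sections is closed under $[\![\cdot,\cdot]\!]$. Let $L$ be a Dirac structure and let $R$ be an almost Dirac structure with $L\oplus R=\mathbb{T}M$. Identify $R\cong L^*$ by $r\mapsto \langle r,\cdot\rangle|_L$. Then $L$ is a Lie algebroid with differential $d_L$ on $\Gamma(\wedge L^*)$. Let $[\cdot,\cdot]_{L^*}$ be the graded skew-symmetric bracket of degree $-1$ on $\Gamma(\wedge L^*)$ that is a graded derivation of $\wedge$ in each entry and satisfies $[\xi,\eta]_{L^*}=\mathrm{pr}_R[\![\xi,\eta]\!]$, $[\xi,f]_{L^*}=\rho(\xi)f$ and $[f,g]_{L^*}=0$ for $\xi,\eta\in\Gamma(R)\cong\Gamma(L^*)$ and $f,g\in C^\infty(M)$, where $\rho\colon\mathbb{T}M\to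 TM$ is the projection. Let $\psi\in\Gamma(\wedge^3L)$ be given by $\psi(\xi_1,\xi_2,\xi_3)=\langle \mathrm{pr}_L[\![\xi_1,\xi_2]\!],\xi_3\rangle$. On homogeneous elements of $\Gamma(\wedge L^*)$ (up to the shift in $\Gamma(\wedge L^*)[2]$) consider the multibrackets $$\mu_1=d_L,\qquad \mu_2(\alpha,\beta)=-(-1)^{|\alpha|}[\alpha,\beta]_{L^*},\qquad \mu_3(\alpha,\beta,\gamma)=(-1)^{|\beta|}(\alpha^\sharp\wedge\beta^\sharp\wedge\gamma^\sharp)\psi,$$ where $(\alpha^\sharp\wedge\beta^\sharp\wedge\gamma^\sharp)(v_1\wedge v_2\wedge v_3)=\sum_{\sigma\in S_3}(-1)^{\sigma}\,\iota_{v_{\sigma(1)}}\alpha\wedge\iota_{v_{\sigma(2)}}\beta\wedge\iota_{v_{\sigma(3)}}\gamma$. Let $K\subset L$ be a vector subbundle, let $\Gamma_{\mathrm{hor}}(\wedge L^*)$ be the kernel of the restriction map $\Gamma(\wedge L^*)\to\Gamma(\wedge K^*)$, and let $K^\circ\subset L^*\cong R$ be the annihilator of $K$. Then $\mu_1$, $\mu_2$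 and $\mu_3$ all preserve $\Gamma_{\mathrm{hor}}(\wedge L^*)$ if and only if both of the following hold: (a) $K$ is a Lie subalgebroid of $L$, that is, $[\![\Gamma(K),\Gamma(K)]\!]\subset\Gamma(K)$; (b) $\langle[\![\xi_1,\xi_2]\!],e\rangle=0$ for all $\xi_1,\xi_2\in\Gamma(K^\circ)$ and all $e\in K+K^\circ$. -/

import Mathlib

open scoped Manifold ContDiff
open Bundle

noncomputable section

namespace DiracGeometry

section Courant

variable {E : Type*} [NormedAddCommGroup E] [NormedSpace ℝ E]
  {M : Type*} [TopologicalSpace M] [ChartedSpace E M]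

/-- The fibre at `x` of the generalized tangent bundle `𝕋M = TM ⊕ T*M`. -/
abbrev GenTangent (E : Type*) [NormedAddCommGroup E] [NormedSpace ℝ E]
    {M : Type*} [TopologicalSpace M] [ChartedSpace E M] (x : M) : Type _ :=
  TangentSpace 𝓘(ℝ, E) x × (TangentSpace 𝓘(ℝ, E) x →L[ℝ] ℝ)

instance (x : M) : AddCommGroup (GenTangent E x) := Prod.instAddCommGroup

instance (x : M) : Module ℝ (GenTangent E x) := Prod.instModule

/-- Set-theoretic sections `s = (X, α)` of `𝕋M`. -/
abbrev RawSection (E : Type*) [NormedAddCommGroup E] [NormedSpace ℝ E]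
    (M : Type*) [TopologicalSpace M] [ChartedSpace E M] : Type _ :=
  ∀ x : M, GenTangent E x

/-- The symmetric pairing `⟨(X, α), (Y, β)⟩ = α(Y) + β(X)`. -/
def pairing (x : M) : GenTangent E x →ₗ[ℝ] GenTangent E x →ₗ[ℝ] ℝ :=
  LinearMap.mk₂ ℝ (fun a b => a.2 b.1 + b.2 a.1)
    (fun a a' b => by
      have h : (a + a').2 b.1 = a.2 b.1 + a'.2 b.1 := rfl
      rw [h, Prod.fst_add, map_add]
      ring)
    (fun c a b => by
      have h : (c • a).2 b.1 = c • a.2 b.1 := rfl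
      rw [h, Prod.smul_fst, map_smul, smul_add])
    (fun a b b' => by
      have h : (b + b').2 a.1 = b.2 a.1 + b'.2 a.1 := rfl
      rw [h, Prod.fst_add, map_add]
      ring)
    (fun c a b => by
      have h : (c • b).2 a.1 = c • b.2 a.1 := rfl
      rw [h, Prod.smul_fst, map_smul, smul_add])

/-- The derivative `ρ(s) f = X(f)` of a function along the anchor `ρ(X, α) = X`. -/
def anchorDeriv (s : RawSection E M) (f : M → ℝ) (x : M) : ℝ :=
  mfderiv 𝓘(ℝ, E) 𝓘(ℝ, ℝ) f x (s x).1

/-- A `1`-form read in the chart at `x₀`, i.e. its pullback under the inverse of that chart. -/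
def chartForm (α : ∀ x : M, TangentSpace 𝓘(ℝ, E) x →L[ℝ] ℝ) (x₀ : M) (y : E) : E →L[ℝ] ℝ :=
  (α ((extChartAt 𝓘(ℝ, E) x₀).symm y)).comp
    (mfderiv 𝓘(ℝ, E) 𝓘(ℝ, E) (extChartAt 𝓘(ℝ, E) x₀).symm y)

/-- The exterior derivative of a `1`-form: in a chart,
`dα(v, w) = (∂ᵥ α)(w) - (∂_w α)(v)`; here it is computed at `x` in the chart at `x`. -/
def extDerivOne (α : ∀ x : M, TangentSpace 𝓘(ℝ, E) x →L[ℝ] ℝ) (x : M) :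
    TangentSpace 𝓘(ℝ, E) x →L[ℝ] TangentSpace 𝓘(ℝ, E) x →L[ℝ] ℝ :=
  let A : E →L[ℝ] E →L[ℝ] ℝ := fderiv ℝ (chartForm α x) (extChartAt 𝓘(ℝ, E) x x)
  let φ : E →L[ℝ] E := mfderiv 𝓘(ℝ, E) 𝓘(ℝ, E) (extChartAt 𝓘(ℝ, E) x) x
  let B : E →L[ℝ] E →L[ℝ] ℝ := (A - A.flip).bilinearComp φ φ
  B

/-- The Lie derivative of a `1`-form, `L_X β = ι_X dβ + d(β(X))`. -/
def lieDerivOne (X : ∀ x : M, TangentSpace 𝓘(ℝ, E) x)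
    (β : ∀ x : M, TangentSpace 𝓘(ℝ, E) x →L[ℝ] ℝ) (x : M) : TangentSpace 𝓘(ℝ, E) x →L[ℝ] ℝ :=
  let d : TangentSpace 𝓘(ℝ, E) x →L[ℝ] ℝ := mfderiv 𝓘(ℝ, E) 𝓘(ℝ, ℝ) (fun y => β y (X y)) x
  extDerivOne β x (X x) + d

/-- The Dorfman bracket `⟦(X, α), (Y, β)⟧ = ([X, Y], L_X β - ι_Y dα)`. -/
def dorfman (s t : RawSection E M) : RawSection E M := fun x =>
  (VectorField.mlieBracket 𝓘(ℝ, E) (fun y => (s y).1) (fun y => (t y).1) x,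
    lieDerivOne (fun y => (s y).1) (fun y => (t y).2) x
      - extDerivOne (fun y => (s y).2) x (t x).1)

/-- A section of `𝕋M` is smooth on `U` if its components are smooth on `U` as sections of `TM` and
of `T*M`. -/
def SmoothOn [IsManifold 𝓘(ℝ, E) ∞ M] (s : RawSection E M) (U : Set M) : Prop :=
  ContMDiffOn 𝓘(ℝ, E) (𝓘(ℝ, E).prod 𝓘(ℝ, E)) ∞
    (fun x => TotalSpace.mk' E (E := fun y : M => TangentSpace 𝓘(ℝ, E) y) x (s x).1) U ∧
  ContMDiffOn 𝓘(ℝ, E) (𝓘(ℝ, E).prod 𝓘(ℝ, E →L[ℝ] ℝ)) ∞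
    (fun x => TotalSpace.mk' (E →L[ℝ] ℝ)
      (E := fun y : M => TangentSpace 𝓘(ℝ, E) y →L[ℝ] ℝ) x (s x).2) U

end Courant

/-- A smooth vector subbundle of `𝕋M`: a family of subspaces of the fibres which near every point
has a smooth frame. -/
structure Subbundle (E : Type*) [NormedAddCommGroup E] [NormedSpace ℝ E]
    (M : Type*) [TopologicalSpace M] [ChartedSpace E M] [IsManifold 𝓘(ℝ, E) ∞ M] where
  fiber : ∀ x : M, Submodule ℝ (GenTangent E x)
  exists_frame : ∀ x₀ : M, ∃ (U : Set M) (k : ℕ) (s : Fin k → RawSection E M),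
    IsOpen U ∧ x₀ ∈ U ∧ (∀ i, SmoothOn (s i) U) ∧
    ∀ x ∈ U, LinearIndependent ℝ (fun i => s i x) ∧
      Submodule.span ℝ (Set.range fun i => s i x) = fiber x

variable {E : Type*} [NormedAddCommGroup E] [NormedSpace ℝ E]
  {M : Type*} [TopologicalSpace M] [ChartedSpace E M] [IsManifold 𝓘(ℝ, E) ∞ M]

namespace Subbundle

/-- `s` is a smooth (global) section of the subbundle `V`. -/
def IsSection (V : Subbundle E M) (s : RawSection E M) : Prop :=
  SmoothOn s Set.univ ∧ ∀ x, s x ∈ V.fiber x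

/-- The space of sections `Γ(V)`. -/
def Sections (V : Subbundle E M) : Type _ := {s : RawSection E M // V.IsSection s}

/-- The value of a section at a point, as an element of the fibre. -/
def Sections.at {V : Subbundle E M} (s : V.Sections) (x : M) : V.fiber x := ⟨s.1 x, s.2.2 x⟩

/-- The space of sections of `V` is closed under the Dorfman bracket. -/
def IsInvolutive (V : Subbundle E M) : Prop :=
  ∀ s t : RawSection E M, V.IsSection s → V.IsSection t → V.IsSection (dorfman s t)

/-- Almost Dirac structures: Lagrangian subbundles of `𝕋M`. -/
def IsAlmostDirac (L : Subbundle E M) : Prop :=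
  ∀ x, (∀ w ∈ L.fiber x, ∀ w' ∈ L.fiber x, pairing x w w' = 0) ∧
    Module.finrank ℝ (L.fiber x) = Module.finrank ℝ E

/-- Dirac structures: almost Dirac structures closed under the Dorfman bracket. -/
def IsDirac (L : Subbundle E M) : Prop := L.IsAlmostDirac ∧ L.IsInvolutive

/-- Smooth sections `Γ(∧ᵏ V*)`: families of alternating `k`-forms on the fibres of `V` whose values
on smooth sections of `V` are smooth functions. -/
structure Form (V : Subbundle E M) (k : ℕ) where
  toFun : ∀ x : M, V.fiber x [⋀^Fin k]→ₗ[ℝ] ℝ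
  smooth : ∀ X : Fin k → V.Sections,
    ContMDiff 𝓘(ℝ, E) 𝓘(ℝ, ℝ) ∞ fun x => toFun x fun i => (X i).at x

/-- The function `θ(X₁, …, X_k)`. -/
def Form.eval {V : Subbundle E M} {k : ℕ} (θ : V.Form k) (X : Fin k → V.Sections) (x : M) : ℝ :=
  θ.toFun x fun i => (X i).at x

/-- The functions `Γ(V)ᵏ → (M → ℝ)`. An element of `Γ(∧ᵏ V*)` is determined by the function
`(X₁, …, X_k) ↦ θ(X₁, …, X_k)` in this space, and the multibrackets below are given by it. -/
abbrev Cochain (V : Subbundle E M) (k : ℕ) : Type _ := (Fin k → V.Sections) → M → ℝ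

end Subbundle

/-- A Dirac structure `L` together with a complementary almost Dirac structure `R`,
so that `L ⊕ R = 𝕋M`. -/
structure DiracSplitting (E : Type*) [NormedAddCommGroup E] [NormedSpace ℝ E]
    (M : Type*) [TopologicalSpace M] [ChartedSpace E M] [IsManifold 𝓘(ℝ, E) ∞ M] where
  L : Subbundle E M
  R : Subbundle E M
  isDirac : L.IsDirac
  isAlmostDirac : R.IsAlmostDirac
  isCompl : ∀ x, IsCompl (L.fiber x) (R.fiber x)

namespace DiracSplitting

variable (S : DiracSplitting E M)

/-- The projection `pr_L : 𝕋M → L` along `R`, applied to sections. -/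
def prL (s : RawSection E M) : RawSection E M :=
  fun x => (S.L.fiber x).projection (S.R.fiber x) (S.isCompl x) (s x)

/-- The projection `pr_R : 𝕋M → R` along `L`, applied to sections. -/
def prR (s : RawSection E M) : RawSection E M :=
  fun x => (S.R.fiber x).projection (S.L.fiber x) (S.isCompl x).symm (s x)

/-- The map `R → L*`, `r ↦ ⟨r, ·⟩|_L`, on the fibres over `x`. -/
def toDual (x : M) : S.R.fiber x →ₗ[ℝ] Module.Dual ℝ (S.L.fiber x) :=
  ((pairing x).domRestrict (S.R.fiber x)).compl₂ (S.L.fiber x).subtype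

lemma toDual_injective (x : M) : Function.Injective (S.toDual x) := by
  rw [← LinearMap.ker_eq_bot, LinearMap.ker_eq_bot']
  intro r hr
  have hL : ∀ v ∈ S.L.fiber x, pairing x (r : GenTangent E x) v = 0 := fun v hv =>
    LinearMap.congr_fun hr ⟨v, hv⟩
  have hR : ∀ v ∈ S.R.fiber x, pairing x (r : GenTangent E x) v = 0 := fun v hv =>
    (S.isAlmostDirac x).1 _ r.2 _ hv
  have key : ∀ v : GenTangent E x, pairing x (r : GenTangent E x) v = 0 := by
    intro v
    have hv : v ∈ S.L.fiber x ⊔ S.R.fiber x := by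
      rw [(S.isCompl x).sup_eq_top]; trivial
    obtain ⟨a, ha, b, hb, rfl⟩ := Submodule.mem_sup.mp hv
    rw [map_add, hL a ha, hR b hb, add_zero]
  have h2 : (r : GenTangent E x).2 = 0 := by
    ext v
    simpa [pairing] using key (v, 0)
  have h1 : (r : GenTangent E x).1 = 0 := by
    by_contra hne
    have hsep : ∀ v : E, v ≠ 0 → ∃ g : E →L[ℝ] ℝ, g v ≠ 0 := fun v hv =>
      SeparatingDual.exists_ne_zero hv
    obtain ⟨g, hg⟩ := hsep (r : GenTangent E x).1 hne
    have h := key ((0 : TangentSpace 𝓘(ℝ, E) x), (g : E →L[ℝ] ℝ))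
    have h' : (r : GenTangent E x).2 0 + g (r : GenTangent E x).1 = 0 := h
    rw [map_zero, zero_add] at h'
    exact hg h'
  exact Subtype.ext (Prod.ext h1 h2)

/-- The canonical isomorphism `R ≅ L*`, `r ↦ ⟨r, ·⟩|_L`, on the fibres over `x`. -/
def dualEquiv [FiniteDimensional ℝ E] (x : M) :
    S.R.fiber x ≃ₗ[ℝ] Module.Dual ℝ (S.L.fiber x) :=
  haveI : FiniteDimensional ℝ (TangentSpace 𝓘(ℝ, E) x) := ‹FiniteDimensional ℝ E›
  LinearEquiv.ofInjectiveOfFinrankEq (S.toDual x) (S.toDual_injective x)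
    (by rw [Subspace.dual_finrank_eq, (S.isAlmostDirac x).2, (S.isDirac.1 x).2])

/-- The Lie algebroid bracket of `L`: the restriction of the Dorfman bracket to `Γ(L)`. -/
def bracketL (X Y : S.L.Sections) : S.L.Sections :=
  ⟨dorfman X.1 Y.1, S.isDirac.2 X.1 Y.1 X.2 Y.2⟩

/-- The bracket `pr_R ⟦ξ, η⟧` of the almost Lie algebroid `R ≅ L*`. -/
def bracketR (ξ η : RawSection E M) : RawSection E M := S.prR (dorfman ξ η)

/-- `⟨ξ, X⟩` for sections `ξ` and `X`. -/
def pair (ξ X : RawSection E M) (x : M) : ℝ := pairing x (ξ x) (X x)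

/-- The `1`-form `α(·, X₁, …, X_p)` on `L`, regarded as a section of `R` by means of `R ≅ L*`. -/
def contract [FiniteDimensional ℝ E] {p : ℕ} (α : S.L.Form (p + 1)) (X : Fin p → S.L.Sections) :
    RawSection E M := fun x =>
  ((S.dualEquiv x).symm
    { toFun := fun v => α.toFun x (Matrix.vecCons v fun i => (X i).at x)
      map_add' := fun v w => (α.toFun x).map_vecCons_add _ v w
      map_smul' := fun c v => (α.toFun x).map_vecCons_smul _ c v } : S.R.fiber x)

/-- The differential `μ₁ = d_L` of the Lie algebroid `L`:
`(d_L θ)(X₀, …, X_k) = ∑ᵢ (-1)ⁱ ρ(Xᵢ) (θ(X₀, …, X̂ᵢ, …, X_k))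
  + ∑_{i<j} (-1)^{i+j} θ([Xᵢ, Xⱼ], X₀, …, X̂ᵢ, …, X̂ⱼ, …, X_k)`. -/
def mu1 : {k : ℕ} → S.L.Form k → S.L.Cochain (k + 1)
  | 0, f => fun X x => anchorDeriv (X 0).1 (f.eval ![]) x
  | k + 1, θ => fun X x =>
    (∑ i : Fin (k + 2), (-1 : ℝ) ^ (i : ℕ) *
      anchorDeriv (X i).1 (θ.eval fun l => X (i.succAbove l)) x) +
    ∑ j : Fin (k + 2), ∑ i : Fin (k + 1), if i.castSucc < j then
      (-1 : ℝ) ^ ((i : ℕ) + (j : ℕ)) *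
        θ.eval (Fin.cons (S.bracketL (X i.castSucc) (X j))
          fun l => X (j.succAbove (i.succAbove l))) x
      else 0

/-- For `|α| = p + 1` and `|β| = q`, the sum over `(p, q)`-shuffles (written as a normalized sum
over permutations) of `± ρ(α(·, X_I)) (β(X_J))`, where `α(·, X_I) ∈ Γ(L*) ≅ Γ(R)`. It is zero for
functions `α`. -/
def anchorPart [FiniteDimensional ℝ E] : {p : ℕ} → S.L.Form p → {q : ℕ} → S.L.Form q →
    {n : ℕ} → n + 1 = p + q → S.L.Cochain n
  | 0, _, _, _, _, _ => fun _ _ => 0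
  | p + 1, α, q, β, n, h => fun X x =>
    ((p.factorial : ℝ) * (q.factorial : ℝ))⁻¹ * ∑ σ : Equiv.Perm (Fin n),
      ((Equiv.Perm.sign σ : ℤ) : ℝ) *
        anchorDeriv
          (S.contract α fun i : Fin p => X (σ (Fin.cast (by omega) (Fin.castAdd q i))))
          (β.eval fun j : Fin q => X (σ (Fin.cast (by omega) (Fin.natAdd p j)))) x

/-- For sections `ξ, η` of `R ≅ L*` and `X` of `L`:
`⟨pr_R ⟦ξ, η⟧, X⟩ - ρ(ξ)⟨η, X⟩ + ρ(η)⟨ξ, X⟩`. -/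
def structurePairing (ξ η X : RawSection E M) (x : M) : ℝ :=
  pair (S.bracketR ξ η) X x - anchorDeriv ξ (pair η X) x + anchorDeriv η (pair ξ X) x

/-- For `|α| = p + 1` and `|β| = q + 1`, the sum over `(p, 1, q)`-shuffles of
`± structurePairing (α(·, X_I)) (β(·, X_J)) Xᵢ`. It is zero if `α` or `β` is a function. -/
def structurePart [FiniteDimensional ℝ E] : {p : ℕ} → S.L.Form p → {q : ℕ} → S.L.Form q →
    {n : ℕ} → n + 1 = p + q → S.L.Cochain n
  | 0, _, _, _, _, _ => fun _ _ => 0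
  | _ + 1, _, 0, _, _, _ => fun _ _ => 0
  | p + 1, α, q + 1, β, n, h => fun X x =>
    ((p.factorial : ℝ) * (q.factorial : ℝ))⁻¹ * ∑ σ : Equiv.Perm (Fin n),
      ((Equiv.Perm.sign σ : ℤ) : ℝ) *
        S.structurePairing
          (S.contract α fun i : Fin p =>
            X (σ (Fin.cast (by omega) (Fin.castAdd q (Fin.castAdd 1 i)))))
          (S.contract β fun j : Fin q => X (σ (Fin.cast (by omega) (Fin.natAdd (p + 1) j))))
          (X (σ (Fin.cast (by omega) (Fin.castAdd q (Fin.natAdd p (0 : Fin 1)))))).1 x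

/-- The Schouten-type extension `[·,·]_{L*}` of the bracket `pr_R ⟦·,·⟧` of `R ≅ L*` to
`Γ(∧ L*)`, i.e. the bracket of degree `-1` with `[ξ, η] = pr_R ⟦ξ, η⟧`, `[ξ, f] = ρ(ξ) f`,
`[f, g] = 0`, `[α, β] = -(-1)^{(|α|-1)(|β|-1)} [β, α]` and
`[α, β ∧ γ] = [α, β] ∧ γ + (-1)^{(|α|-1)|β|} β ∧ [α, γ]`, given by its values on sections of `L`.

These rules say that for local dual frames `eᵢ` of `L` and `rᵢ` of `R`, with `∇ᵢ` denoting the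
derivative of the coefficients in the frame along `ρ(rᵢ)`, and `ι` the insertion into the first
slot,
`[α, β] = (-1)^{|α|-1} ∑ᵢ ι_{eᵢ} α ∧ ∇ᵢ β - ∑ᵢ ∇ᵢ α ∧ ι_{eᵢ} β
  + (-1)^{|α|-1} ∑ᵢⱼ ι_{eᵢ} α ∧ pr_R ⟦rᵢ, rⱼ⟧ ∧ ι_{eⱼ} β`.
Evaluated on sections `X` of the frame, the three terms are the terms below; the derivatives in
`structurePairing` vanish on the frames and make the expression function-linear in the `X`. The
bracket of two functions has degree `-1` and is omitted. -/
def schouten [FiniteDimensional ℝ E] {p q : ℕ} (α : S.L.Form p) (β : S.L.Form q)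
    {n : ℕ} (h : n + 1 = p + q) : S.L.Cochain n := fun X x =>
  (-1 : ℝ) ^ (p - 1) * S.anchorPart α β h X x
    - (-1 : ℝ) ^ ((q - 1) * p) * S.anchorPart β α (h.trans (Nat.add_comm p q)) X x
    + (-1 : ℝ) ^ (p - 1) * S.structurePart α β h X x

/-- `μ₂(α, β) = -(-1)^{|α|} [α, β]_{L*}`. -/
def mu2 [FiniteDimensional ℝ E] {p q : ℕ} (α : S.L.Form p) (β : S.L.Form q)
    {n : ℕ} (h : n + 1 = p + q) : S.L.Cochain n := fun X x =>
  -(-1 : ℝ) ^ p * S.schouten α β h X x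

/-- The trivector `ψ ∈ Γ(∧³ L)`, `ψ(ξ₁, ξ₂, ξ₃) = ⟨pr_L ⟦ξ₁, ξ₂⟧, ξ₃⟩` for `ξᵢ` in
`Γ(R) ≅ Γ(L*)`. -/
def psi (ξ₁ ξ₂ ξ₃ : RawSection E M) (x : M) : ℝ := pair (S.prL (dorfman ξ₁ ξ₂)) ξ₃ x

/-- The values on sections of `L` of `(α♯ ∧ β♯ ∧ γ♯) ψ`, where
`(α♯ ∧ β♯ ∧ γ♯)(v₁ ∧ v₂ ∧ v₃) = ∑_{σ ∈ S₃} (-1)^σ ι_{v_σ(1)} α ∧ ι_{v_σ(2)} β ∧ ι_{v_σ(3)} γ`.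
For `ψ = v₁ ∧ v₂ ∧ v₃` one has `ψ(ξ₁, ξ₂, ξ₃) = ∑_σ (-1)^σ ξ₁(v_σ(1)) ξ₂(v_σ(2)) ξ₃(v_σ(3))`, so
the value on the `X` is the sum over shuffles of `± ψ(α(·, X_I), β(·, X_J), γ(·, X_K))`; this
expression is linear in `ψ`. It is zero if one of the forms is a function. -/
def sharpPsi [FiniteDimensional ℝ E] : {p : ℕ} → S.L.Form p → {q : ℕ} → S.L.Form q →
    {r : ℕ} → S.L.Form r → {n : ℕ} → n + 3 = p + q + r → S.L.Cochain n
  | p + 1, α, q + 1, β, r + 1, γ, n, h => fun X x =>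
    ((p.factorial : ℝ) * (q.factorial : ℝ) * (r.factorial : ℝ))⁻¹ *
      ∑ σ : Equiv.Perm (Fin n), ((Equiv.Perm.sign σ : ℤ) : ℝ) *
        S.psi
          (S.contract α fun i : Fin p =>
            X (σ (Fin.cast (by omega) (Fin.castAdd r (Fin.castAdd q i)))))
          (S.contract β fun j : Fin q =>
            X (σ (Fin.cast (by omega) (Fin.castAdd r (Fin.natAdd p j)))))
          (S.contract γ fun l : Fin r =>
            X (σ (Fin.cast (by omega) (Fin.natAdd (p + q) l)))) x
  | 0, _, _, _, _, _, _, _ => fun _ _ => 0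
  | _ + 1, _, 0, _, _, _, _, _ => fun _ _ => 0
  | _ + 1, _, _ + 1, _, 0, _, _, _ => fun _ _ => 0

/-- `μ₃(α, β, γ) = (-1)^{|β|} (α♯ ∧ β♯ ∧ γ♯) ψ`. -/
def mu3 [FiniteDimensional ℝ E] {p q r : ℕ} (α : S.L.Form p) (β : S.L.Form q) (γ : S.L.Form r)
    {n : ℕ} (h : n + 3 = p + q + r) : S.L.Cochain n := fun X x =>
  (-1 : ℝ) ^ q * S.sharpPsi α β γ h X x

variable {S}

/-- `θ ∈ Γ_hor(∧ᵏ L*)`: the restriction of `θ` to `K ⊆ L` is zero. -/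
def IsHorizontal {K : Subbundle E M} (hK : ∀ x, K.fiber x ≤ S.L.fiber x) {k : ℕ}
    (θ : S.L.Form k) : Prop :=
  ∀ x, (θ.toFun x).compLinearMap (Submodule.inclusion (hK x)) = 0

/-- The same condition for a form given by its values on sections of `L`: it vanishes on all
sections with values in `K` (every vector of `K` is the value of a section of `K`). -/
def IsHorizontalCochain (K : Subbundle E M) {k : ℕ} (F : S.L.Cochain k) : Prop :=
  ∀ X : Fin k → S.L.Sections, (∀ i x, (X i).1 x ∈ K.fiber x) → ∀ x, F X x = 0

variable (S)

/-- The multibrackets `μ₁, μ₂, μ₃` map horizontal forms to horizontal forms. -/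
def MultibracketsPreserveHorizontal [FiniteDimensional ℝ E] {K : Subbundle E M}
    (hK : ∀ x, K.fiber x ≤ S.L.fiber x) : Prop :=
  (∀ (k : ℕ) (θ : S.L.Form k), IsHorizontal hK θ → IsHorizontalCochain K (S.mu1 θ)) ∧
  (∀ (p q n : ℕ) (h : n + 1 = p + q) (α : S.L.Form p) (β : S.L.Form q),
    IsHorizontal hK α → IsHorizontal hK β → IsHorizontalCochain K (S.mu2 α β h)) ∧
  (∀ (p q r n : ℕ) (h : n + 3 = p + q + r) (α : S.L.Form p) (β : S.L.Form q) (γ : S.L.Form r),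
    IsHorizontal hK α → IsHorizontal hK β → IsHorizontal hK γ →
      IsHorizontalCochain K (S.mu3 α β γ h))

/-- `K ⊆ L` is a Lie subalgebroid: its sections are closed under the bracket of `Γ(L)`. -/
def IsLieSubalgebroid (K : Subbundle E M) : Prop :=
  ∀ X Y : S.L.Sections, K.IsSection X.1 → K.IsSection Y.1 → K.IsSection (S.bracketL X Y).1

/-- The fibre at `x` of the annihilator `K° ⊆ L* ≅ R` of `K`, as a subspace of `R`. -/
def annihilator (K : Subbundle E M) (x : M) : Submodule ℝ (GenTangent E x) where
  carrier := {r | r ∈ S.R.fiber x ∧ ∀ v ∈ K.fiber x, pairing x r v = 0}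
  add_mem' := fun ha hb => ⟨add_mem ha.1 hb.1, fun v hv => by
    rw [map_add, LinearMap.add_apply, ha.2 v hv, hb.2 v hv, add_zero]⟩
  zero_mem' := ⟨zero_mem _, fun v _ => by simp⟩
  smul_mem' := fun c r hr => ⟨Submodule.smul_mem _ c hr.1, fun v hv => by
    rw [map_smul, LinearMap.smul_apply, hr.2 v hv, smul_zero]⟩

/-- `ξ ∈ Γ(K°)`. -/
def IsAnnihilatorSection (K : Subbundle E M) (ξ : RawSection E M) : Prop :=
  SmoothOn ξ Set.univ ∧ ∀ x, ξ x ∈ S.annihilator K x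

end DiracSplitting

end DiracGeometry

end

open scoped Topology

namespace DiracGeometry

variable {E : Type*} [NormedAddCommGroup E] [NormedSpace ℝ E]
  {M : Type*} [TopologicalSpace M] [ChartedSpace E M]

lemma anchorDeriv_zero (s : RawSection E M) (x : M) : anchorDeriv s (fun _ => 0) x = 0 := by
  simp only [anchorDeriv, mfderiv_const]
  rfl

/-- A smooth function valued in square matrices which is invertible at a point has a smooth inverse
nearby. -/
lemma exists_smooth_inverse {k : ℕ} {G : M → Matrix (Fin k) (Fin k) ℝ} {U : Set M} (hU : IsOpen U)
    {x₀ : M} (hx₀ : x₀ ∈ U) (hG : ∀ i j, ContMDiffOn 𝓘(ℝ, E) 𝓘(ℝ, ℝ) ∞ (fun x => G x i j) U)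
    (h0 : (G x₀).det ≠ 0) :
    ∃ U' ⊆ U, IsOpen U' ∧ x₀ ∈ U' ∧ (∀ x ∈ U', (G x)⁻¹ * G x = 1) ∧
      ∀ i j, ContMDiffOn 𝓘(ℝ, E) 𝓘(ℝ, ℝ) ∞ (fun x => (G x)⁻¹ i j) U' := by
  have det_smooth : ∀ H : M → Matrix (Fin k) (Fin k) ℝ,
      (∀ i j, ContMDiffOn 𝓘(ℝ, E) 𝓘(ℝ, ℝ) ∞ (fun x => H x i j) U) →
      ContMDiffOn 𝓘(ℝ, E) 𝓘(ℝ, ℝ) ∞ (fun x => (H x).det) U := by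
    intro H hH
    simp only [Matrix.det_apply']
    refine contMDiffOn_finsetSum fun σ _ => ?_
    exact contMDiffOn_const.mul (contMDiffOn_finsetProd fun i _ => hH _ _)
  have hdet := det_smooth G hG
  refine ⟨U ∩ (fun x => (G x).det) ⁻¹' {0}ᶜ, Set.inter_subset_left,
    hdet.continuousOn.isOpen_inter_preimage hU isOpen_compl_singleton, ⟨hx₀, h0⟩,
    fun x hx => Matrix.nonsing_inv_mul _ (isUnit_iff_ne_zero.mpr hx.2), fun i j => ?_⟩
  -- Cramer's rule: each entry is `det⁻¹` times the determinant of the matrix with one row replaced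
  -- by a constant basis vector.
  simp only [Matrix.inv_def, Ring.inverse_eq_inv', Matrix.smul_apply, Matrix.adjugate_apply,
    smul_eq_mul]
  refine ((hdet.mono Set.inter_subset_left).inv₀ fun x hx => hx.2).mul
    ((det_smooth _ fun a b => ?_).mono Set.inter_subset_left)
  by_cases h : a = j
  · subst h
    simpa using contMDiffOn_const
  · simpa [Matrix.updateRow_ne h] using hG a b

variable [IsManifold 𝓘(ℝ, E) ∞ M]

/-! ### Smooth sections of `𝕋M` and cut-offs -/

namespace SmoothOn

variable {s t : RawSection E M} {U V : Set M}

lemma mono (hs : SmoothOn s V) (h : U ⊆ V) : SmoothOn s U :=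
  ⟨hs.1.mono h, hs.2.mono h⟩

lemma congr (hs : SmoothOn s U) (h : ∀ x ∈ U, t x = s x) : SmoothOn t U :=
  ⟨hs.1.congr fun x hx => by simp only [h x hx], hs.2.congr fun x hx => by simp only [h x hx]⟩

lemma add (hs : SmoothOn s U) (ht : SmoothOn t U) : SmoothOn (fun x => s x + t x) U :=
  ⟨hs.1.add_section ht.1, hs.2.add_section ht.2⟩

lemma smul {f : M → ℝ} (hf : ContMDiffOn 𝓘(ℝ, E) 𝓘(ℝ, ℝ) ∞ f U) (hs : SmoothOn s U) :
    SmoothOn (fun x => f x • s x) U :=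
  ⟨hf.smul_section hs.1, hf.smul_section hs.2⟩

lemma zero : SmoothOn (fun x => (0 : GenTangent E x)) U :=
  ⟨(contMDiff_zeroSection ℝ (fun x : M => TangentSpace 𝓘(ℝ, E) x)).contMDiffOn,
    (contMDiff_zeroSection ℝ (fun x : M => TangentSpace 𝓘(ℝ, E) x →L[ℝ] ℝ)).contMDiffOn⟩

lemma sum {ι : Type*} (I : Finset ι) {s : ι → RawSection E M}
    (hs : ∀ i ∈ I, SmoothOn (s i) U) : SmoothOn (fun x => ∑ i ∈ I, s i x) U := by
  classical
  induction I using Finset.induction_on with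
  | empty => simpa using zero
  | insert a I ha ih =>
    refine ((hs a (by simp)).add (ih fun i hi => hs i (by simp [hi]))).congr fun x _ => ?_
    rw [Finset.sum_insert ha]

/-- Smoothness on the whole manifold is local. -/
lemma univ_of_forall_exists (h : ∀ x, ∃ U, IsOpen U ∧ x ∈ U ∧ SmoothOn s U) :
    SmoothOn s Set.univ := by
  constructor <;> rw [contMDiffOn_univ] <;> intro x <;> obtain ⟨U, hU, hx, hs⟩ := h x
  · exact hs.1.contMDiffAt (hU.mem_nhds hx)
  · exact hs.2.contMDiffAt (hU.mem_nhds hx)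

lemma pairing (hs : SmoothOn s U) (ht : SmoothOn t U) :
    ContMDiffOn 𝓘(ℝ, E) 𝓘(ℝ, ℝ) ∞ (fun x => pairing x (s x) (t x)) U := by
  have key : ∀ {s t : RawSection E M}, SmoothOn s U → SmoothOn t U →
      ContMDiffOn 𝓘(ℝ, E) 𝓘(ℝ, ℝ) ∞ (fun x => (s x).2 (t x).1) U := by
    intro s t hs ht x hx
    have h : ContMDiffWithinAt 𝓘(ℝ, E) (𝓘(ℝ, E).prod 𝓘(ℝ, ℝ)) ∞
        (fun m : M => TotalSpace.mk' ℝ (E := Bundle.Trivial M ℝ) m ((s m).2 (t m).1)) U x :=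
      ContMDiffWithinAt.clm_bundle_apply (F₁ := E) (F₂ := ℝ)
        (E₁ := fun y : M => TangentSpace 𝓘(ℝ, E) y) (E₂ := Bundle.Trivial M ℝ)
        (b := fun m => m) (hs.2 x hx) (ht.1 x hx)
    rw [contMDiffWithinAt_totalSpace] at h
    exact h.2
  exact (key hs ht).add (key ht hs)

end SmoothOn

/-- A local section can be cut off to a global one without changing it near a given point. -/
lemma exists_cutoff [FiniteDimensional ℝ E] [T2Space M] {U : Set M} (hU : IsOpen U) {x₀ : M}
    (hx₀ : x₀ ∈ U) :
    ∃ f : M → ℝ, f =ᶠ[𝓝 x₀] 1 ∧ (∀ x ∉ U, f x = 0) ∧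
      ∀ s : RawSection E M, SmoothOn s U → SmoothOn (fun x => f x • s x) Set.univ := by
  obtain ⟨f, -, hf⟩ := (SmoothBumpFunction.nhds_basis_tsupport (I := 𝓘(ℝ, E)) x₀).mem_iff.mp
    (hU.mem_nhds hx₀)
  refine ⟨f, f.eventuallyEq_one, fun x hx => ?_, fun s hs => ?_⟩
  · exact image_eq_zero_of_notMem_tsupport fun h => hx (hf h)
  · exact ⟨(ContMDiffOn.smul_section_of_tsupport f.contMDiff.contMDiffOn hU hf hs.1).contMDiffOn,
      (ContMDiffOn.smul_section_of_tsupport f.contMDiff.contMDiffOn hU hf hs.2).contMDiffOn⟩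

/-- Every vector of a subbundle is the value of a section. -/
lemma Subbundle.exists_section_eq [FiniteDimensional ℝ E] [T2Space M] (V : Subbundle E M) {x₀ : M}
    {v : GenTangent E x₀} (hv : v ∈ V.fiber x₀) : ∃ s, V.IsSection s ∧ s x₀ = v := by
  obtain ⟨U, k, s, hU, hx₀, hs, hV⟩ := V.exists_frame x₀
  obtain ⟨f, hf1, hf0, hf⟩ := exists_cutoff (E := E) hU hx₀
  rw [← (hV x₀ hx₀).2, Submodule.mem_span_range_iff_exists_fun] at hv
  obtain ⟨c, rfl⟩ := hv
  -- The coefficients of `v` in the frame at `x₀` are kept constant, and the result is cut off.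
  refine ⟨fun x => f x • ∑ i, c i • s i x, ⟨hf _ ?_, fun x => ?_⟩, ?_⟩
  · exact SmoothOn.sum _ fun i _ => SmoothOn.smul contMDiffOn_const (hs i)
  · by_cases hx : x ∈ U
    · refine Submodule.smul_mem _ _ (Submodule.sum_mem _ fun i _ => Submodule.smul_mem _ _ ?_)
      rw [← (hV x hx).2]
      exact Submodule.subset_span ⟨i, rfl⟩
    · simp only [hf0 x hx, zero_smul, zero_mem]
  · simp only [hf1.eq_of_nhds, Pi.one_apply, one_smul]

namespace DiracSplitting

variable (S : DiracSplitting E M)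

/-! ### The Lagrangian splitting and the test 1-forms -/

lemma prL_add_prR (s : RawSection E M) (x : M) : S.prL s x + S.prR s x = s x :=
  Submodule.projection_add_projection_eq_self (S.isCompl x) (s x)

lemma prL_mem (s : RawSection E M) (x : M) : S.prL s x ∈ S.L.fiber x :=
  Submodule.projection_apply_mem _ _

lemma prR_mem (s : RawSection E M) (x : M) : S.prR s x ∈ S.R.fiber x :=
  Submodule.projection_apply_mem _ _

/-- The discarded `L`-component pairs to zero with `v` because `L` is isotropic. This and its mirror
image for `R` remove the projections from the structure terms and from `psi`. -/
lemma pairing_prR (s : RawSection E M) {x : M} {v : GenTangent E x} (hv : v ∈ S.L.fiber x) :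
    pairing x (S.prR s x) v = pairing x (s x) v := by
  rw [← S.prL_add_prR s x, map_add, LinearMap.add_apply,
    (S.isDirac.1 x).1 _ (S.prL_mem s x) _ hv, zero_add]

lemma pairing_prL (s : RawSection E M) {x : M} {v : GenTangent E x} (hv : v ∈ S.R.fiber x) :
    pairing x (S.prL s x) v = pairing x (s x) v := by
  rw [← S.prL_add_prR s x, map_add, LinearMap.add_apply,
    (S.isAlmostDirac x).1 _ (S.prR_mem s x) _ hv, add_zero]

/-- Elements of `R` are determined by their pairings with a spanning family of `L`. -/
lemma eq_of_pairing_eq {x : M} {r r' : GenTangent E x} (hr : r ∈ S.R.fiber x)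
    (hr' : r' ∈ S.R.fiber x) {ι : Type*} {v : ι → GenTangent E x}
    (hv : S.L.fiber x ≤ Submodule.span ℝ (Set.range v))
    (h : ∀ i, pairing x r (v i) = pairing x r' (v i)) : r = r' := by
  have key : Submodule.span ℝ (Set.range v) ≤ LinearMap.ker (pairing x (r - r')) := by
    rw [Submodule.span_le]
    rintro _ ⟨i, rfl⟩
    simp [h i]
  have : (⟨r, hr⟩ : S.R.fiber x) = ⟨r', hr'⟩ := by
    refine S.toDual_injective x (LinearMap.ext fun w => ?_)
    have h2 : pairing x (r - r') w.1 = 0 := key (hv w.2)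
    rw [map_sub, LinearMap.sub_apply, sub_eq_zero] at h2
    exact h2
  exact congrArg Subtype.val this

/-- The `1`-form `⟨ξ, ·⟩` on `L`. -/
noncomputable def formOfSection {ξ : RawSection E M} (hξ : SmoothOn ξ Set.univ) : S.L.Form 1 where
  toFun x := AlternatingMap.ofSubsingleton ℝ (S.L.fiber x) ℝ (0 : Fin 1)
    ((pairing x (ξ x)).domRestrict (S.L.fiber x))
  smooth X := contMDiffOn_univ.mp (hξ.pairing (X 0).2.1)

lemma formOfSection_horizontal {K : Subbundle E M} (hK : ∀ x, K.fiber x ≤ S.L.fiber x)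
    {ξ : RawSection E M} (hξ : S.IsAnnihilatorSection K ξ) :
    IsHorizontal hK (S.formOfSection hξ.1) := by
  intro x
  ext v
  exact (hξ.2 x).2 _ (v 0).2

lemma mu1_formOfSection {ξ : RawSection E M} (hξ : SmoothOn ξ Set.univ) (X Y : S.L.Sections)
    (x : M) : S.mu1 (S.formOfSection hξ) ![X, Y] x =
      anchorDeriv X.1 (pair ξ Y.1) x - anchorDeriv Y.1 (pair ξ X.1) x
        - pair ξ (S.bracketL X Y).1 x := by
  have hpair : ∀ Z : Fin 1 → S.L.Sections, (S.formOfSection hξ).eval Z = pair ξ (Z 0).1 :=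
    fun Z => rfl
  simp only [mu1, hpair]
  simp [Fin.sum_univ_succ]
  ring

/-- On sections of `K`, the structure part of the bracket of sections of `K°` is the Dorfman
bracket. -/
lemma structurePairing_eq {K : Subbundle E M} (hK : ∀ x, K.fiber x ≤ S.L.fiber x)
    {ξ η X : RawSection E M} (hξ : S.IsAnnihilatorSection K ξ) (hη : S.IsAnnihilatorSection K η)
    (hX : ∀ x, X x ∈ K.fiber x) (x : M) :
    S.structurePairing ξ η X x = pairing x (dorfman ξ η x) (X x) := by
  -- The pairings vanish on all of `M`, not only at `x`, so their anchor derivatives vanish too.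
  have h1 : pair ξ X = fun _ => 0 := funext fun y => (hξ.2 y).2 _ (hX y)
  have h2 : pair η X = fun _ => 0 := funext fun y => (hη.2 y).2 _ (hX y)
  rw [structurePairing, h1, h2, anchorDeriv_zero, anchorDeriv_zero, sub_zero, add_zero]
  exact S.pairing_prR _ (hK x (hX x))

section

/-! ### Horizontal forms under `mu1`, and contractions -/

variable {S} {K : Subbundle E M} {hK : ∀ x, K.fiber x ≤ S.L.fiber x}

lemma IsHorizontal.apply_eq_zero {k : ℕ} {θ : S.L.Form k} (hθ : IsHorizontal hK θ) {x : M}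
    {v : Fin k → S.L.fiber x} (hv : ∀ i, (v i : GenTangent E x) ∈ K.fiber x) :
    θ.toFun x v = 0 :=
  DFunLike.congr_fun (hθ x) fun i => (⟨v i, hv i⟩ : K.fiber x)

lemma IsHorizontal.eval_eq_zero {k : ℕ} {θ : S.L.Form k} (hθ : IsHorizontal hK θ)
    {X : Fin k → S.L.Sections} (hX : ∀ i x, (X i).1 x ∈ K.fiber x) : θ.eval X = fun _ => 0 :=
  funext fun x => hθ.apply_eq_zero fun i => hX i x

lemma mu1_horizontal (hinv : S.IsLieSubalgebroid K) {k : ℕ} {θ : S.L.Form k}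
    (hθ : IsHorizontal hK θ) : IsHorizontalCochain K (S.mu1 θ) := by
  intro X hX x
  cases k with
  | zero =>
    -- In degree zero the condition on the arguments is vacuous, so a horizontal function is zero.
    have h : θ.eval ![] = fun _ => 0 := hθ.eval_eq_zero fun i => i.elim0
    simp only [mu1, h, anchorDeriv_zero]
  | succ k =>
    have h1 : ∀ i : Fin (k + 2), θ.eval (fun l => X (i.succAbove l)) = fun _ => 0 :=
      fun i => hθ.eval_eq_zero fun l => hX _
    -- Involutivity of `K` enters only here, for the bracket in slot zero.
    have h2 : ∀ (j : Fin (k + 2)) (i : Fin (k + 1)),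
        θ.eval (Fin.cons (S.bracketL (X i.castSucc) (X j))
          fun l => X (j.succAbove (i.succAbove l))) = fun _ => 0 := fun j i =>
      hθ.eval_eq_zero fun l => Fin.cases
        (hinv _ _ ⟨(X i.castSucc).2.1, hX _⟩ ⟨(X j).2.1, hX _⟩).2 (fun l => hX _) l
    simp [mu1, h1, h2, anchorDeriv_zero]

end

variable [FiniteDimensional ℝ E]

lemma pairing_dualEquiv_symm {x : M} (φ : Module.Dual ℝ (S.L.fiber x)) (v : S.L.fiber x) :
    pairing x ((S.dualEquiv x).symm φ : GenTangent E x) v = φ v :=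
  LinearMap.congr_fun ((S.dualEquiv x).apply_symm_apply φ) v

lemma contract_mem {p : ℕ} (α : S.L.Form (p + 1)) (X : Fin p → S.L.Sections) (x : M) :
    S.contract α X x ∈ S.R.fiber x :=
  Subtype.property _

lemma pairing_contract {p : ℕ} (α : S.L.Form (p + 1)) (X : Fin p → S.L.Sections) {x : M}
    {v : GenTangent E x} (hv : v ∈ S.L.fiber x) :
    pairing x (S.contract α X x) v =
      α.toFun x (Matrix.vecCons ⟨v, hv⟩ fun i => (X i).at x) :=
  S.pairing_dualEquiv_symm _ ⟨v, hv⟩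

lemma contract_formOfSection {ξ : RawSection E M} (hξ : SmoothOn ξ Set.univ)
    (hR : ∀ x, ξ x ∈ S.R.fiber x) (X : Fin 0 → S.L.Sections) :
    S.contract (S.formOfSection hξ) X = ξ := by
  funext x
  refine S.eq_of_pairing_eq (S.contract_mem _ X x) (hR x)
    (v := fun w : S.L.fiber x => (w : GenTangent E x)) (by simp) fun w => ?_
  exact S.pairing_contract _ X w.2

lemma structurePart_formOfSection {ξ η : RawSection E M} (hξ : SmoothOn ξ Set.univ)
    (hη : SmoothOn η Set.univ) (hξR : ∀ x, ξ x ∈ S.R.fiber x) (hηR : ∀ x, η x ∈ S.R.fiber x)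
    (X : Fin 1 → S.L.Sections) (x : M) :
    S.structurePart (S.formOfSection hξ) (S.formOfSection hη) rfl X x =
      S.structurePairing ξ η (X 0).1 x := by
  simp [structurePart, contract_formOfSection, hξR, hηR]

lemma mu3_formOfSection {ξ η ζ : RawSection E M} (hξ : SmoothOn ξ Set.univ)
    (hη : SmoothOn η Set.univ) (hζ : SmoothOn ζ Set.univ) (hξR : ∀ x, ξ x ∈ S.R.fiber x)
    (hηR : ∀ x, η x ∈ S.R.fiber x) (hζR : ∀ x, ζ x ∈ S.R.fiber x) (x : M) :
    S.mu3 (S.formOfSection hξ) (S.formOfSection hη) (S.formOfSection hζ) (n := 0) rfl ![] x =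
      -pairing x (dorfman ξ η x) (ζ x) := by
  simp [mu3, sharpPsi, contract_formOfSection, hξR, hηR, hζR, psi, pair, S.pairing_prL _ (hζR x)]

section

variable {S} {K : Subbundle E M} {hK : ∀ x, K.fiber x ≤ S.L.fiber x}

/-- Every summand differentiates a function `β(X_J)` that is identically zero, so only the
differentiated form has to be horizontal. Applied with both orders of the forms, this disposes of
the derivative terms of the Schouten bracket. -/
lemma anchorPart_eq_zero {p q n : ℕ} (h : n + 1 = p + q) (α : S.L.Form p) {β : S.L.Form q}
    (hβ : IsHorizontal hK β) {X : Fin n → S.L.Sections} (hX : ∀ i x, (X i).1 x ∈ K.fiber x)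
    (x : M) : S.anchorPart α β h X x = 0 := by
  cases p with
  | zero => rfl
  | succ p =>
    rw [anchorPart]
    beta_reduce
    rw [Finset.sum_eq_zero, mul_zero]
    intro σ _
    rw [hβ.eval_eq_zero fun j => hX _, anchorDeriv_zero, mul_zero]

end

/-! ### Local dual frames and sections of `K°` -/

variable [T2Space M]

/-- Pointwise independent local sections of `L` have local dual sections of `R`. -/
lemma exists_dual_sections {k : ℕ} {l : Fin k → RawSection E M} {U : Set M} (hU : IsOpen U)
    {x₀ : M} (hx₀ : x₀ ∈ U) (hl : ∀ i, SmoothOn (l i) U) (hmem : ∀ i, l i x₀ ∈ S.L.fiber x₀)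
    (hli : LinearIndependent ℝ fun i => l i x₀) :
    ∃ U' ⊆ U, IsOpen U' ∧ x₀ ∈ U' ∧ ∃ r : Fin k → RawSection E M,
      (∀ i, SmoothOn (r i) U') ∧ (∀ i x, r i x ∈ S.R.fiber x) ∧
      ∀ x ∈ U', ∀ i j, pairing x (r i x) (l j x) = if i = j then 1 else 0 := by
  have hli' : LinearIndependent ℝ fun i => (⟨l i x₀, hmem i⟩ : S.L.fiber x₀) :=
    LinearIndependent.of_comp (S.L.fiber x₀).subtype hli
  have hq : ∀ i, ∃ q, S.R.IsSection q ∧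
      ∀ j, pairing x₀ (q x₀) (l j x₀) = if i = j then 1 else 0 := by
    intro i
    obtain ⟨φ, hφ⟩ : ∃ φ : Module.Dual ℝ (S.L.fiber x₀),
        ∀ j, φ ⟨l j x₀, hmem j⟩ = if i = j then 1 else 0 := by
      -- The `l j x₀` need not span `L`, so the `i`-th coordinate functional on their span is
      -- extended to the whole fibre.
      obtain ⟨φ, hφ⟩ := LinearMap.exists_extend ((Finsupp.lapply i) ∘ₗ hli'.repr)
      refine ⟨φ, fun j => ?_⟩
      have hj := hli'.repr_eq_single j
        ⟨⟨l j x₀, hmem j⟩, Submodule.subset_span ⟨j, rfl⟩⟩ rfl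
      refine (LinearMap.congr_fun hφ _).trans ((DFunLike.congr_fun hj i).trans ?_)
      rw [Finsupp.single_apply]
      simp only [eq_comm]
    obtain ⟨q, hq, hq0⟩ := S.R.exists_section_eq ((S.dualEquiv x₀).symm φ).2
    refine ⟨q, hq, fun j => ?_⟩
    rw [hq0, ← hφ j, ← S.pairing_dualEquiv_symm]
  choose q hq hqd using hq
  -- The sections `q i` are dual to the `l j` only at `x₀`. There the Gram matrix is the identity,
  -- hence it is invertible nearby, and its inverse corrects the `q i` to dual sections.
  obtain ⟨U', hU'U, hU', hx₀', hinv, hsm⟩ :=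
    exists_smooth_inverse (G := fun x => Matrix.of fun i j => pairing x (q i x) (l j x)) hU hx₀
      (fun i j => ((hq i).1.mono (Set.subset_univ _)).pairing (hl j)) (by
        have : (Matrix.of fun i j => pairing x₀ (q i x₀) (l j x₀)) = 1 := by
          ext i j
          simp [hqd, Matrix.one_apply]
        simp [this])
  refine ⟨U', hU'U, hU', hx₀', fun i x => ∑ j, (Matrix.of fun i j =>
    pairing x (q i x) (l j x))⁻¹ i j • q j x, fun i => ?_, fun i x => ?_, fun x hx i j => ?_⟩
  · exact SmoothOn.sum _ fun j _ => SmoothOn.smul (hsm i j) ((hq j).1.mono (Set.subset_univ _))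
  · exact Submodule.sum_mem _ fun j _ => Submodule.smul_mem _ _ ((hq j).2 x)
  · have h := congrFun (congrFun (hinv x hx) i) j
    rw [Matrix.mul_apply, Matrix.one_apply] at h
    rw [← h]
    simp

/-- The sections `α(·, X₁, …, X_p)` of `R ≅ L*` are smooth. -/
lemma contract_smooth {p : ℕ} (α : S.L.Form (p + 1)) (X : Fin p → S.L.Sections) :
    SmoothOn (S.contract α X) Set.univ := by
  refine SmoothOn.univ_of_forall_exists fun x₀ => ?_
  obtain ⟨U, k, l, hU, hx₀, hl, hL⟩ := S.L.exists_frame x₀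
  have hmem : ∀ x ∈ U, ∀ i, l i x ∈ S.L.fiber x := fun x hx i => by
    rw [← (hL x hx).2]
    exact Submodule.subset_span ⟨i, rfl⟩
  obtain ⟨V, hVU, hV, hx₀V, r, hr, hrR, hrl⟩ :=
    S.exists_dual_sections hU hx₀ hl (hmem x₀ hx₀) (hL x₀ hx₀).1
  -- Smoothness of a `Form` is tested on global sections only, so the frame is cut off to `Y`, which
  -- agrees with it on `W`. There the contraction is `∑ⱼ α(Yⱼ, X) rⱼ`.
  obtain ⟨f, hf1, hf0, hf⟩ := exists_cutoff (E := E) hU hx₀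
  obtain ⟨W, hW1, hW, hx₀W⟩ := eventually_nhds_iff.mp hf1
  let Y : Fin k → S.L.Sections := fun i => ⟨fun x => f x • l i x, hf _ (hl i), fun x => by
    by_cases hx : x ∈ U
    · exact Submodule.smul_mem _ _ (hmem x hx i)
    · simp only [hf0 x hx, zero_smul, zero_mem]⟩
  refine ⟨V ∩ W, hV.inter hW, ⟨hx₀V, hx₀W⟩, SmoothOn.congr (SmoothOn.sum Finset.univ
    (s := fun j x => α.eval (Matrix.vecCons (Y j) X) x • r j x) fun j _ => SmoothOn.smul
      (α.smooth _).contMDiffOn ((hr j).mono Set.inter_subset_left)) fun x hx => ?_⟩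
  have hxU := hVU hx.1
  refine S.eq_of_pairing_eq (S.contract_mem α X x)
    (Submodule.sum_mem _ fun j _ => Submodule.smul_mem _ _ (hrR j x)) (hL x hxU).2.ge fun i => ?_
  have hY : (Y i).at x = ⟨l i x, hmem x hxU i⟩ := Subtype.ext (by
    simp [Y, Subbundle.Sections.at, hW1 x hx.2])
  rw [S.pairing_contract α X (hmem x hxU i), ← hY]
  simp only [map_sum, map_smul, LinearMap.sum_apply, LinearMap.smul_apply, hrl x hx.1, smul_eq_mul,
    mul_ite, mul_one, mul_zero, Finset.sum_ite_eq', Finset.mem_univ, if_true, Subbundle.Form.eval]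
  congr 1
  funext j
  refine Fin.cases ?_ (fun j => ?_) j <;> simp

/-- Every element of the annihilator `K°` is the value of a section. -/
lemma exists_annihilator_section_eq {K : Subbundle E M} (hK : ∀ x, K.fiber x ≤ S.L.fiber x) {x₀ : M}
    {e : GenTangent E x₀} (he : e ∈ S.annihilator K x₀) :
    ∃ ξ, S.IsAnnihilatorSection K ξ ∧ ξ x₀ = e := by
  obtain ⟨U, k, l, hU, hx₀, hl, hKl⟩ := K.exists_frame x₀
  have hmem : ∀ x ∈ U, ∀ i, l i x ∈ K.fiber x := fun x hx i => by
    rw [← (hKl x hx).2]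
    exact Submodule.subset_span ⟨i, rfl⟩
  obtain ⟨V, hVU, hV, hx₀V, r, hr, hrR, hrl⟩ :=
    S.exists_dual_sections hU hx₀ hl (fun i => hK x₀ (hmem x₀ hx₀ i)) (hKl x₀ hx₀).1
  obtain ⟨ζ, hζ, hζ0⟩ := S.R.exists_section_eq he.1
  obtain ⟨f, hf1, hf0, hf⟩ := exists_cutoff (E := E) hV hx₀V
  -- Subtracting the components of `ζ` along the dual sections forces `η` into `K°`. At `x₀` the
  -- correction is zero because `e` already annihilates `K`.
  let c : Fin k → M → ℝ := fun j x => -pairing x (ζ x) (l j x)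
  let η : RawSection E M := fun x => ζ x + ∑ j, c j x • r j x
  have hη : SmoothOn η V := (hζ.1.mono (Set.subset_univ _)).add (SmoothOn.sum _ fun j _ =>
    SmoothOn.smul (((hζ.1.mono (Set.subset_univ _)).pairing ((hl j).mono hVU)).neg) (hr j))
  refine ⟨fun x => f x • η x, ⟨hf η hη, fun x => ?_⟩, ?_⟩
  · by_cases hx : x ∈ V
    · refine Submodule.smul_mem _ _ ⟨add_mem (hζ.2 x) (Submodule.sum_mem _ fun j _ =>
        Submodule.smul_mem _ _ (hrR j x)), fun v hv => ?_⟩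
      have key : Submodule.span ℝ (Set.range fun i => l i x) ≤ LinearMap.ker (pairing x (η x)) := by
        rw [Submodule.span_le]
        rintro _ ⟨i, rfl⟩
        simp [η, c, hrl x hx]
      exact key ((hKl x (hVU hx)).2.ge hv)
    · simp only [hf0 x hx, zero_smul, zero_mem]
  · have hc : ∀ j, c j x₀ = 0 := fun j => by simp [c, hζ0, he.2 _ (hmem x₀ hx₀ j)]
    simp [η, hc, hf1.eq_of_nhds, hζ0]

/-! ### The two implications, bracket by bracket -/

variable {S} {K : Subbundle E M} {hK : ∀ x, K.fiber x ≤ S.L.fiber x}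

/-- Pairing the contraction with `v ∈ K` evaluates `α` entirely on `K`. This turns statements about
forms of any degree into statements about sections of `K°`. -/
lemma IsHorizontal.contract_isAnnihilatorSection {p : ℕ} {α : S.L.Form (p + 1)}
    (hα : IsHorizontal hK α) {X : Fin p → S.L.Sections} (hX : ∀ i x, (X i).1 x ∈ K.fiber x) :
    S.IsAnnihilatorSection K (S.contract α X) := by
  refine ⟨S.contract_smooth α X, fun x => ⟨S.contract_mem α X x, fun v hv => ?_⟩⟩
  rw [S.pairing_contract α X (hK x hv)]
  exact hα.apply_eq_zero fun i => Fin.cases hv (fun i => hX i x) i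

lemma mu2_horizontal
    (hD : ∀ ξ₁ ξ₂ : RawSection E M, S.IsAnnihilatorSection K ξ₁ → S.IsAnnihilatorSection K ξ₂ →
      ∀ x, ∀ e ∈ K.fiber x, pairing x (dorfman ξ₁ ξ₂ x) e = 0)
    {p q n : ℕ} (h : n + 1 = p + q) {α : S.L.Form p} {β : S.L.Form q} (hα : IsHorizontal hK α)
    (hβ : IsHorizontal hK β) : IsHorizontalCochain K (S.mu2 α β h) := by
  intro X hX x
  have hstr : S.structurePart α β h X x = 0 := by
    rcases p with - | p
    · rfl
    rcases q with - | q
    · rfl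
    rw [structurePart]
    beta_reduce
    rw [Finset.sum_eq_zero, mul_zero]
    intro σ _
    have h1 := hα.contract_isAnnihilatorSection (X := fun i : Fin p =>
      X (σ (Fin.cast (by omega) (Fin.castAdd q (Fin.castAdd 1 i))))) fun i => hX _
    have h2 := hβ.contract_isAnnihilatorSection (X := fun j : Fin q =>
      X (σ (Fin.cast (by omega) (Fin.natAdd (p + 1) j)))) fun i => hX _
    rw [S.structurePairing_eq hK h1 h2 (hX _), hD _ _ h1 h2 _ _ (hX _ x), mul_zero]
  rw [mu2, schouten, anchorPart_eq_zero h α hβ hX, anchorPart_eq_zero _ β hα hX, hstr]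
  simp

lemma mu3_horizontal
    (hD : ∀ ξ₁ ξ₂ : RawSection E M, S.IsAnnihilatorSection K ξ₁ → S.IsAnnihilatorSection K ξ₂ →
      ∀ x, ∀ e ∈ S.annihilator K x, pairing x (dorfman ξ₁ ξ₂ x) e = 0)
    {p q r n : ℕ} (h : n + 3 = p + q + r) {α : S.L.Form p} {β : S.L.Form q} {γ : S.L.Form r}
    (hα : IsHorizontal hK α) (hβ : IsHorizontal hK β) (hγ : IsHorizontal hK γ) :
    IsHorizontalCochain K (S.mu3 α β γ h) := by
  intro X hX x
  rw [mu3]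
  rcases p with - | p
  · simp [sharpPsi]
  rcases q with - | q
  · simp [sharpPsi]
  rcases r with - | r
  · simp [sharpPsi]
  rw [sharpPsi]
  beta_reduce
  rw [Finset.sum_eq_zero, mul_zero, mul_zero]
  intro σ _
  have h1 := hα.contract_isAnnihilatorSection (X := fun i : Fin p =>
    X (σ (Fin.cast (by omega) (Fin.castAdd r (Fin.castAdd q i))))) fun i => hX _
  have h2 := hβ.contract_isAnnihilatorSection (X := fun j : Fin q =>
    X (σ (Fin.cast (by omega) (Fin.castAdd r (Fin.natAdd p j))))) fun i => hX _
  have h3 := hγ.contract_isAnnihilatorSection (X := fun l : Fin r =>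
    X (σ (Fin.cast (by omega) (Fin.natAdd (p + q) l)))) fun i => hX _
  rw [psi, pair, S.pairing_prL _ (h3.2 x).1, hD _ _ h1 h2 x _ (h3.2 x), mul_zero]

/-- If `[X, Y]` left `K` at a point, a functional on `L` that vanishes on `K` but not on `[X, Y]`
would extend to some `ξ ∈ Γ(K°)`. The Cartan formula then gives `(d_L ξ)(X, Y) = -⟨ξ, [X, Y]⟩ ≠ 0`
there. -/
lemma isLieSubalgebroid_of_mu1
    (h : ∀ θ : S.L.Form 1, IsHorizontal hK θ → IsHorizontalCochain K (S.mu1 θ)) :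
    S.IsLieSubalgebroid K := by
  intro X Y hX hY
  refine ⟨(S.bracketL X Y).2.1, fun x => ?_⟩
  by_contra hx
  obtain ⟨φ, hφ, hKφ⟩ := Submodule.exists_le_ker_of_notMem
    (p := (K.fiber x).comap (S.L.fiber x).subtype) (v := (S.bracketL X Y).at x) hx
  obtain ⟨ξ, hξ, hξx⟩ := S.exists_annihilator_section_eq hK
    (e := ((S.dualEquiv x).symm φ : GenTangent E x)) ⟨Subtype.property _, fun v hv =>
      (S.pairing_dualEquiv_symm φ ⟨v, hK x hv⟩).trans (hKφ (x := ⟨v, hK x hv⟩) hv)⟩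
  have h0 := h _ (S.formOfSection_horizontal hK hξ) ![X, Y]
    (fun i => by refine Fin.cases hX.2 (fun i => ?_) i; simpa using hY.2) x
  have h1 : pair ξ X.1 = fun _ => 0 := funext fun y => (hξ.2 y).2 _ (hX.2 y)
  have h2 : pair ξ Y.1 = fun _ => 0 := funext fun y => (hξ.2 y).2 _ (hY.2 y)
  rw [mu1_formOfSection, h1, h2, anchorDeriv_zero, anchorDeriv_zero, sub_zero, zero_sub,
    neg_eq_zero, pair, hξx] at h0
  exact hφ ((S.pairing_dualEquiv_symm φ ((S.bracketL X Y).at x)).symm.trans h0)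

/-- For the 1-forms of `ξ` and `η`, evaluated on a section of `K` through `e`, the anchor parts
vanish, and `mu2` is the required pairing up to sign. -/
lemma pairing_dorfman_eq_zero_of_mu2
    (h : ∀ α β : S.L.Form 1, IsHorizontal hK α → IsHorizontal hK β →
      IsHorizontalCochain K (S.mu2 α β (n := 1) rfl))
    {ξ η : RawSection E M} (hξ : S.IsAnnihilatorSection K ξ) (hη : S.IsAnnihilatorSection K η)
    {x : M} {e : GenTangent E x} (he : e ∈ K.fiber x) :
    pairing x (dorfman ξ η x) e = 0 := by
  obtain ⟨X, hX, rfl⟩ := K.exists_section_eq he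
  have hα := S.formOfSection_horizontal hK hξ
  have hβ := S.formOfSection_horizontal hK hη
  let Y : Fin 1 → S.L.Sections := fun _ => ⟨X, hX.1, fun y => hK y (hX.2 y)⟩
  have hY : ∀ i y, (Y i).1 y ∈ K.fiber y := fun _ => hX.2
  have h0 : S.mu2 (S.formOfSection hξ.1) (S.formOfSection hη.1) (n := 1) rfl Y x = 0 :=
    h _ _ hα hβ _ hY x
  rw [mu2, schouten, anchorPart_eq_zero _ _ hβ hY, anchorPart_eq_zero _ _ hα hY,
    S.structurePart_formOfSection hξ.1 hη.1 (fun y => (hξ.2 y).1) (fun y => (hη.2 y).1),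
    S.structurePairing_eq hK hξ hη hX.2] at h0
  simpa using h0

end DiracSplitting

end DiracGeometry

theorem mainTheorem6
    {E : Type*} [NormedAddCommGroup E] [NormedSpace ℝ E] [FiniteDimensional ℝ E]
    {M : Type*} [TopologicalSpace M] [ChartedSpace E M] [IsManifold 𝓘(ℝ, E) ∞ M]
    [T2Space M] [SecondCountableTopology M]
    (S : DiracGeometry.DiracSplitting E M) (K : DiracGeometry.Subbundle E M)
    (hK : ∀ x, K.fiber x ≤ S.L.fiber x) :
    S.MultibracketsPreserveHorizontal hK ↔
      S.IsLieSubalgebroid K ∧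
      ∀ ξ₁ ξ₂ : DiracGeometry.RawSection E M,
        S.IsAnnihilatorSection K ξ₁ → S.IsAnnihilatorSection K ξ₂ →
        ∀ x, ∀ e ∈ K.fiber x ⊔ S.annihilator K x,
          DiracGeometry.pairing x (DiracGeometry.dorfman ξ₁ ξ₂ x) e = 0 := by
  constructor
  · rintro ⟨h1, h2, h3⟩
    refine ⟨DiracGeometry.DiracSplitting.isLieSubalgebroid_of_mu1 (h1 1),
      fun ξ₁ ξ₂ hξ₁ hξ₂ x e he => ?_⟩
    obtain ⟨k, hk, r, hr, rfl⟩ := Submodule.mem_sup.mp he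
    obtain ⟨ξ₃, hξ₃, rfl⟩ := S.exists_annihilator_section_eq hK hr
    -- The `K`-component of `e` is handled by `mu2`, the `K°`-component by `mu3` on three 1-forms,
    -- with values in functions. The negation matches the sign `(-1)^{|β|} = -1`.
    rw [map_add, DiracGeometry.DiracSplitting.pairing_dorfman_eq_zero_of_mu2 (h2 1 1 1 rfl)
      hξ₁ hξ₂ hk, zero_add, ← neg_eq_zero, ← S.mu3_formOfSection hξ₁.1 hξ₂.1 hξ₃.1
        (fun y => (hξ₁.2 y).1) (fun y => (hξ₂.2 y).1) (fun y => (hξ₃.2 y).1)]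
    exact h3 1 1 1 0 rfl _ _ _ (S.formOfSection_horizontal hK hξ₁)
      (S.formOfSection_horizontal hK hξ₂) (S.formOfSection_horizontal hK hξ₃) _
      (fun i => i.elim0) x
  · rintro ⟨ha, hb⟩
    exact ⟨fun _ _ hθ => DiracGeometry.DiracSplitting.mu1_horizontal ha hθ,
      fun _ _ _ h _ _ hα hβ => DiracGeometry.DiracSplitting.mu2_horizontal
        (fun ξ₁ ξ₂ h1 h2 x e he => hb ξ₁ ξ₂ h1 h2 x e (Submodule.mem_sup_left he)) h hα hβ,
      fun _ _ _ _ h _ _ _ hα hβ hγ => DiracGeometry.DiracSplitting.mu3_horizontal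
        (fun ξ₁ ξ₂ h1 h2 x e he => hb ξ₁ ξ₂ h1 h2 x e (Submodule.mem_sup_right he)) h hα hβ hγ⟩
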